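/- Identify a unital qubit channel, i.e. a completely positive, trace-preserving linear map $Q:\mathbb C^{2\times2}\to\mathbb C^{2\times2}$ with $Q(\tfrac12 I)=\tfrac12 I$, with its Choi matrix $$\begin{pmatrix} Q(E_{11}) & Q(E_{12})\\ Q(E_{21}) & Q(E_{22})\end{pmatrix}=\begin{pmatrix} a & b & c & d\\ \bar b & 1-a & e & -c\\ \bar c & \bar e & 1-a & -b\\ \bar d & -\bar c & -\bar b & a\end{pmatrix},\qquad (a,b,c,d,e)\in\mathbb R\times\mathbb C^4\cong\mathbb R^9,$$ and call a random unital qubit channel uniformly distributed if its coordinates $(a,b,c,d,e)$ are distributed according to normalized Lebesgue measure on the region of $\mathbb R^9$ that corresponds to all unital qubit channels. The Bloch radius of a qubit state $\rho$ (a positive semidefinite $2\times 2$ matrix of trace one) is $\|x\|_2$, where $\rho=\tfrac12(I+x_1\sigma_1+x_2\sigma_2+x_3\sigma_3)$, $x\in\mathbb R^3$ and $\sigma_1,\sigma_2,\sigma_3$ are the Pauli matrices. **Theorem.** Let $\rho$ be a qubit state with Bloch radius $r_0>0$ (so $0<r_0\le 1$), and let $Q$ be a uniformly distributed random unital qubit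 channel. Then the distribution of the Bloch radius of $Q(\rho)$ is absolutely continuous with respect to Lebesgue measure on $\mathbb R$, with density $$\kappa_1(r,r_0)=\frac{315}{16}\,\frac{r^2(r_0^2-r^2)^3}{r_0^9}\,\chi_{[0,r_0]}(r).$$ -/

import Mathlib

open MeasureTheory ProbabilityTheory
open scoped ComplexOrder

noncomputable section

namespace Qubit

/-- Complex `2 × 2` matrices. -/
abbrev Mat2 : Type := Matrix (Fin 2) (Fin 2) ℂ

/-- Linear maps from complex `2 × 2` matrices to themselves. -/
abbrev Superoperator : Type := Mat2 →ₗ[ℂ] Mat2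

/-- A qubit state: a (self-adjoint) positive semidefinite matrix of trace one. -/
def IsState (ρ : Mat2) : Prop :=
  ρ.PosSemidef ∧ ρ.trace = 1

/-- The maximally mixed state `I / 2`. -/
def maximallyMixed : Mat2 := (1 / 2 : ℂ) • (1 : Mat2)

/-- The Pauli matrices, with the sign convention `σ₂ = !![0, i; -i, 0]`. -/
def pauli : Fin 3 → Mat2 :=
  ![!![0, 1; 1, 0], !![0, Complex.I; -Complex.I, 0], !![1, 0; 0, -1]]

/-- The Stokes parametrization `x ↦ (I + x · σ) / 2`. -/
def stokes (x : EuclideanSpace ℝ (Fin 3)) : Mat2 :=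
  (1 / 2 : ℂ) • ((1 : Mat2) + ∑ i, (x i : ℂ) • pauli i)

/-- The Bloch vector of a state `ρ`, with coordinates `Tr (ρ σᵢ)`. By `blochVector_stokes` and
`stokes_blochVector` it is the inverse of the Stokes parametrization. -/
def blochVector (ρ : Mat2) : EuclideanSpace ℝ (Fin 3) :=
  WithLp.toLp 2 fun i => ((ρ * pauli i).trace).re

/-- The Bloch radius: the Euclidean length of the Bloch vector. -/
def blochRadius (ρ : Mat2) : ℝ := ‖blochVector ρ‖

theorem blochVector_stokes (x : EuclideanSpace ℝ (Fin 3)) : blochVector (stokes x) = x := by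
  ext i
  fin_cases i <;>
    simp [blochVector, stokes, pauli, Matrix.trace, Fin.sum_univ_succ, Matrix.mul_apply] <;> ring

theorem stokes_blochVector {ρ : Mat2} (h : ρ.IsHermitian) (ht : ρ.trace = 1) :
    stokes (blochVector ρ) = ρ := by
  have h00 := congrArg Complex.im (h.apply 0 0)
  have h11 := congrArg Complex.im (h.apply 1 1)
  have h01 := h.apply 0 1
  have h01r := congrArg Complex.re h01
  have h01i := congrArg Complex.im h01
  have htr := congrArg Complex.re ht
  simp [Matrix.trace, Fin.sum_univ_succ] at h00 h11 h01r h01i htr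
  ext i j
  fin_cases i <;> fin_cases j <;> apply Complex.ext <;>
    simp [blochVector, stokes, pauli, Matrix.trace, Fin.sum_univ_succ, Matrix.mul_apply] <;>
    linarith

/-- The map `id_n ⊗ Q` on `n × n` block matrices with `2 × 2` blocks: `Q` is applied to every
block. -/
def ampliation (n : ℕ) (Q : Superoperator) (X : Matrix (Fin n × Fin 2) (Fin n × Fin 2) ℂ) :
    Matrix (Fin n × Fin 2) (Fin n × Fin 2) ℂ :=
  Matrix.of fun p q => Q (Matrix.of fun k l => X (p.1, k) (q.1, l)) p.2 q.2

/-- Complete positivity: every `id_n ⊗ Q` preserves positive semidefiniteness. -/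
def IsCompletelyPositive (Q : Superoperator) : Prop :=
  ∀ (n : ℕ) (X : Matrix (Fin n × Fin 2) (Fin n × Fin 2) ℂ),
    X.PosSemidef → (ampliation n Q X).PosSemidef

/-- A qubit channel: a completely positive and trace preserving linear map. -/
def IsChannel (Q : Superoperator) : Prop :=
  IsCompletelyPositive Q ∧ ∀ X : Mat2, (Q X).trace = X.trace

/-- The set of unital qubit channels: the channels that fix the maximally mixed state. -/
def unitalChannels : Set Superoperator :=
  {Q | IsChannel Q ∧ Q maximallyMixed = maximallyMixed}

/-- The block `Q_{ij} = Q E_{ij}` of the Choi matrix of `Q`, where `E_{ij}` is the matrix unit. -/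
def choiBlock (Q : Superoperator) (i j : Fin 2) : Mat2 := Q (Matrix.single i j 1)

/-- The nine real coordinates `(a, b, c, d, e) ∈ ℝ × ℂ⁴` of a unital qubit channel, read off from
its Choi matrix, which has first row of blocks `Q₁₁ = !![a, b; conj b, 1 - a]` and
`Q₁₂ = !![c, d; e, -c]` and is determined by them. -/
def choiCoords (Q : Superoperator) : ℝ × ℂ × ℂ × ℂ × ℂ :=
  ((choiBlock Q 0 0 0 0).re, choiBlock Q 0 0 0 1,
    choiBlock Q 0 1 0 0, choiBlock Q 0 1 0 1, choiBlock Q 0 1 1 0)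

/-- `Q` is a uniformly distributed random unital qubit channel: it is almost surely a unital
channel, and its coordinates are distributed according to normalized Lebesgue measure on the
region of `ℝ × ℂ⁴ ≃ ℝ⁹` that consists of the coordinates of all unital channels. -/
def IsUniformUnitalChannel {Ω : Type*} [MeasurableSpace Ω] (P : Measure Ω)
    (Q : Ω → Superoperator) : Prop :=
  (∀ᵐ ω ∂P, Q ω ∈ unitalChannels) ∧
    pdf.IsUniform (fun ω => choiCoords (Q ω)) (choiCoords '' unitalChannels) P volume

/-- The radial density `κ₁(r, r₀)`, as a function of `r` on the whole real line. -/
def kappaOne (r r₀ : ℝ) : ℝ :=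
  Set.indicator (Set.Icc 0 r₀)
    (fun r => 315 / 16 * (r ^ 2 * (r₀ ^ 2 - r ^ 2) ^ 3 / r₀ ^ 9)) r

end Qubit

end

noncomputable section

namespace Qubit

open Matrix

/-! ### Complete positivity and the Choi matrix -/

/-! Write a unital channel as the depolarizing channel plus a deviation that is real-linear in the
recentred coordinates `(t, b, c, d, e)`. Precomposition with a unitary conjugation preserves
`region`, a set of positive finite volume, so this linear map preserves Lebesgue measure
(`map_linearEquiv_eq_self`). Hence `ρ` may be taken diagonal, and then the Bloch radius of its image
is `2 * r₀ * √(t² + |b|²)` (`blochRadius_apply_eq`): only the joint law of `(t, b)` matters.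

By Fubini, the density of `(t, b)` is proportional to the volume of `fibre t b`. Postcomposition
with a unitary conjugation rotates `(t, b)` to `(s, 0)` with `s² = t² + |b|²`, again preserving
volume. Over `(s, 0)` with `|s| < 1/2`, a diagonal congruence of the Choi matrix identifies the
fibre with `fibre 0 0` and has Jacobian `(1 - 4s²)³` (`preimage_smul_fibre`, `volume_fibre`).

Polar coordinates in dimension three then give a density proportional to `r² (1 - r²/r₀²)³` on `[0,
r₀]`. The volumes of `fibre 0 0` and of `region` are never computed: the constant follows because
both sides are probability measures. -/

theorem IsCompletelyPositive.comp {Q R : Superoperator} (hQ : IsCompletelyPositive Q)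
    (hR : IsCompletelyPositive R) : IsCompletelyPositive (Q ∘ₗ R) :=
  fun n X hX => hQ n _ (hR n X hX)

/-- Conjugation by a matrix, `X ↦ U X Uᴴ`. -/
def conjMap (U : Mat2) : Superoperator where
  toFun X := U * X * Uᴴ
  map_add' X Y := by simp [mul_add, add_mul]
  map_smul' c X := by simp

@[simp] theorem conjMap_apply (U X : Mat2) : conjMap U X = U * X * Uᴴ := rfl

/-- The ampliation of conjugation by `U` is conjugation by `1 ⊗ U`. -/
theorem isCompletelyPositive_conjMap (U : Mat2) : IsCompletelyPositive (conjMap U) := by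
  intro n X hX
  have key : ampliation n (conjMap U) X
      = (kroneckerMap (· * ·) (1 : Matrix (Fin n) (Fin n) ℂ) U) * X *
        (kroneckerMap (· * ·) (1 : Matrix (Fin n) (Fin n) ℂ) U)ᴴ := by
    ext ⟨i, k⟩ ⟨j, l⟩
    simp [ampliation, Matrix.mul_apply, Fintype.sum_prod_type, Matrix.one_apply,
      apply_ite (starRingEnd ℂ)]
  rw [key]
  exact hX.mul_mul_conjTranspose_same _

theorem isCompletelyPositive_sum {ι : Type*} (s : Finset ι) (F : ι → Superoperator)
    (h : ∀ i ∈ s, IsCompletelyPositive (F i)) : IsCompletelyPositive (∑ i ∈ s, F i) := by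
  intro n X hX
  have key : ampliation n (∑ i ∈ s, F i) X = ∑ i ∈ s, ampliation n (F i) X := by
    ext p q
    simp [ampliation, Matrix.sum_apply]
  rw [key]
  exact posSemidef_sum s fun i hi => h i hi n X hX

/-- The Choi matrix of a superoperator. -/
def choi (Q : Superoperator) : Matrix (Fin 2 × Fin 2) (Fin 2 × Fin 2) ℂ :=
  Matrix.of fun p q => Q (Matrix.single p.1 q.1 1) p.2 q.2

/-- The Choi matrix is the ampliation applied to the rank-one projector, up to scale, on the
maximally entangled vector `∑ eᵢ ⊗ eᵢ`. -/
theorem IsCompletelyPositive.posSemidef_choi {Q : Superoperator} (hQ : IsCompletelyPositive Q) :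
    (choi Q).PosSemidef := by
  have h := hQ 2 (vecMulVec (fun p : Fin 2 × Fin 2 => if p.1 = p.2 then (1 : ℂ) else 0)
    (star fun p : Fin 2 × Fin 2 => if p.1 = p.2 then (1 : ℂ) else 0))
    (posSemidef_vecMulVec_self_star _)
  convert h using 1
  ext p q
  have hs : Matrix.single p.1 q.1 (1 : ℂ) = Matrix.of fun k l : Fin 2 =>
      vecMulVec (fun p : Fin 2 × Fin 2 => if p.1 = p.2 then (1 : ℂ) else 0)
        (star fun p : Fin 2 × Fin 2 => if p.1 = p.2 then (1 : ℂ) else 0) (p.1, k) (q.1, l) := by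
    ext k l
    simp only [Matrix.single, of_apply, vecMulVec_apply, Pi.star_apply]
    split_ifs <;> simp_all
  simp only [choi, ampliation, of_apply, hs]

theorem superoperator_apply (Q : Superoperator) (X : Mat2) :
    Q X = ∑ i, ∑ j, X i j • Q (Matrix.single i j 1) := by
  conv_lhs => rw [matrix_eq_sum_single X]
  simp only [map_sum]
  refine Finset.sum_congr rfl fun i _ => Finset.sum_congr rfl fun j _ => ?_
  rw [← map_smul, smul_single, smul_eq_mul, mul_one]

open scoped MatrixOrder in
-- Factor the Choi matrix as `Bᴴ B`: each row of `B` yields a Kraus operator, and `Q` is the sum of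
-- the corresponding conjugations.
theorem isCompletelyPositive_of_posSemidef_choi {Q : Superoperator} (h : (choi Q).PosSemidef) :
    IsCompletelyPositive Q := by
  obtain ⟨B, hB⟩ := CStarAlgebra.nonneg_iff_eq_star_mul_self.mp h.nonneg
  have key : Q = ∑ m, conjMap (Matrix.of fun k i => star (B m (i, k))) := by
    ext1 X
    rw [superoperator_apply]
    ext k l
    have hc : ∀ i j, Q (Matrix.single i j 1) k l = ∑ m, star (B m (i, k)) * B m (j, l) := by
      intro i j
      have := congrFun (congrFun hB (i, k)) (j, l)
      simpa [choi, Matrix.mul_apply] using this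
    simp only [Matrix.sum_apply, Matrix.add_apply, Matrix.smul_apply, hc, LinearMap.sum_apply, conjMap_apply,
      Matrix.mul_apply (m := Fin 2), of_apply, conjTranspose_apply, star_star, smul_eq_mul,
      Finset.mul_sum, Fin.sum_univ_two, ← Finset.sum_add_distrib]
    exact Finset.sum_congr rfl fun m _ => by ring
  rw [key]
  exact isCompletelyPositive_sum _ _ fun m _ => isCompletelyPositive_conjMap _

theorem isCompletelyPositive_iff {Q : Superoperator} :
    IsCompletelyPositive Q ↔ (choi Q).PosSemidef :=
  ⟨fun h => h.posSemidef_choi, isCompletelyPositive_of_posSemidef_choi⟩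

/-! ### Recentred coordinates -/

/-- The channel that maps every state to the maximally mixed state. -/
def depolarizing : Superoperator where
  toFun X := X.trace • maximallyMixed
  map_add' X Y := by simp [add_smul]
  map_smul' c X := by simp [smul_smul]

theorem depolarizing_apply (X : Mat2) : depolarizing X = X.trace • maximallyMixed := rfl

/-- The nine real coordinates `(t, b, c, d, e)`, where `t = a - 1 / 2`. -/
abbrev Coords : Type := ℝ × ℂ × ℂ × ℂ × ℂ

/-- The diagonal Choi block of a superoperator with values of trace zero. -/
def diagBlock (t : ℝ) (b : ℂ) : Mat2 := !![(t : ℂ), b; star b, -(t : ℂ)]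

/-- The off-diagonal Choi block of a superoperator with values of trace zero. -/
def offBlock (q : ℂ × ℂ × ℂ) : Mat2 := !![q.1, q.2.1; q.2.2, -q.1]

/-- The difference between the unital channel with given recentred coordinates and the
depolarizing channel. -/
def deviation : Coords →ₗ[ℝ] Superoperator where
  toFun p :=
    { toFun := fun X => (X 0 0 - X 1 1) • diagBlock p.1 p.2.1 + X 0 1 • offBlock p.2.2
        + X 1 0 • (offBlock p.2.2)ᴴ
      map_add' := fun X Y => by simp only [Matrix.add_apply]; module
      map_smul' := fun c X => by
        simp only [Matrix.smul_apply, smul_eq_mul, RingHom.id_apply]; module }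
  map_add' p q := by
    ext1 X
    ext i j
    fin_cases i <;> fin_cases j <;> simp [diagBlock, offBlock] <;> ring
  map_smul' r p := by
    ext1 X
    ext i j
    fin_cases i <;> fin_cases j <;> simp [diagBlock, offBlock] <;> ring

theorem deviation_apply (p : Coords) (X : Mat2) :
    deviation p X = (X 0 0 - X 1 1) • diagBlock p.1 p.2.1 + X 0 1 • offBlock p.2.2
        + X 1 0 • (offBlock p.2.2)ᴴ := rfl

/-- Superoperators that preserve adjoints, take values of trace zero and vanish at `1`. -/
structure IsDeviation (Q : Superoperator) : Prop where
  conjTranspose : ∀ X, Q Xᴴ = (Q X)ᴴ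
  trace : ∀ X, (Q X).trace = 0
  one : Q 1 = 0

theorem isDeviation_deviation (p : Coords) : IsDeviation (deviation p) where
  conjTranspose X := by
    ext i j
    fin_cases i <;> fin_cases j <;> simp [deviation_apply, diagBlock, offBlock] <;> ring
  trace X := by
    simp [deviation_apply, diagBlock, offBlock, Matrix.trace, Fin.sum_univ_two]
    ring
  one := by simp [deviation_apply]

theorem choiCoords_deviation (p : Coords) : choiCoords (deviation p) = p := by
  obtain ⟨t, b, c, d, e⟩ := p
  simp [choiCoords, choiBlock, deviation_apply, diagBlock, offBlock]

/-- The three conditions force `Q E₂₂ = -Q E₁₁` and `Q E₂₁ = (Q E₁₂)ᴴ`, with `Q E₁₁` Hermitian and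
both blocks traceless, so the nine coordinates determine `Q`. -/
theorem IsDeviation.deviation_choiCoords {Q : Superoperator} (h : IsDeviation Q) :
    deviation (choiCoords Q) = Q := by
  have h1 : Q (Matrix.single 1 1 1) = - Q (Matrix.single 0 0 1) := by
    rw [eq_neg_iff_add_eq_zero, ← map_add, ← h.one]
    congr 1
    ext i j
    fin_cases i <;> fin_cases j <;> simp
  have h2 : Q (Matrix.single 1 0 1) = (Q (Matrix.single 0 1 1))ᴴ := by
    rw [← h.conjTranspose]; simp
  have h3 : Q (Matrix.single 0 0 1) = (Q (Matrix.single 0 0 1))ᴴ := by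
    rw [← h.conjTranspose]; simp
  have h4 := h.trace (Matrix.single 0 0 1)
  have h5 := h.trace (Matrix.single 0 1 1)
  rw [Matrix.trace_fin_two] at h4 h5
  have hd : diagBlock (choiCoords Q).1 (choiCoords Q).2.1 = Q (Matrix.single 0 0 1) := by
    have e00 : star (Q (Matrix.single 0 0 1) 0 0) = Q (Matrix.single 0 0 1) 0 0 :=
      (congrFun (congrFun h3 0) 0).symm
    have e10 : star (Q (Matrix.single 0 0 1) 0 1) = Q (Matrix.single 0 0 1) 1 0 :=
      (congrFun (congrFun h3 1) 0).symm
    have hr : ((Q (Matrix.single 0 0 1) 0 0).re : ℂ) = Q (Matrix.single 0 0 1) 0 0 :=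
      Complex.conj_eq_iff_re.mp e00
    ext i j
    fin_cases i <;> fin_cases j
    · simpa [diagBlock, choiCoords, choiBlock] using hr
    · simp [diagBlock, choiCoords, choiBlock]
    · simpa [diagBlock, choiCoords, choiBlock] using e10
    · simp only [diagBlock, choiCoords, choiBlock]
      simpa [hr] using (eq_neg_of_add_eq_zero_right h4).symm
  have ho : offBlock (choiCoords Q).2.2 = Q (Matrix.single 0 1 1) := by
    ext i j
    fin_cases i <;> fin_cases j <;> simp [offBlock, choiCoords, choiBlock]
    exact (eq_neg_of_add_eq_zero_right h5).symm
  ext1 X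
  rw [superoperator_apply Q X, deviation_apply, hd, ho]
  simp only [Fin.sum_univ_two, h1, h2]
  module

/-- `choiCoords` as a real linear map. -/
def choiCoordsLinear : Superoperator →ₗ[ℝ] Coords where
  toFun := choiCoords
  map_add' Q R := by simp [choiCoords, choiBlock]
  map_smul' r Q := by simp [choiCoords, choiBlock]

@[simp] theorem choiCoordsLinear_apply (Q : Superoperator) :
    choiCoordsLinear Q = choiCoords Q := rfl

/-- The region of recentred coordinates of unital channels. -/
def region : Set Coords := {p | IsCompletelyPositive (deviation p + depolarizing)}

/-- The coordinates of the depolarizing channel. -/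
def centre : Coords := (1 / 2, 0, 0, 0, 0)

theorem choiCoords_depolarizing : choiCoords depolarizing = centre := by
  simp [choiCoords, choiBlock, depolarizing_apply, centre, maximallyMixed]

theorem maximallyMixed_trace : maximallyMixed.trace = 1 := by
  simp [maximallyMixed]

/-- Adjoints are preserved because the Choi matrix is Hermitian; trace preservation and unitality
cancel against those of the depolarizing channel. -/
theorem isDeviation_of_mem_unitalChannels {Q : Superoperator} (hQ : Q ∈ unitalChannels) :
    IsDeviation (Q - depolarizing) where
  conjTranspose X := by
    have hh := hQ.1.1.posSemidef_choi.isHermitian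
    have hs : ∀ i j, Q (Matrix.single i j 1) = (Q (Matrix.single j i 1))ᴴ := by
      intro i j
      ext k l
      exact (hh.apply (i, k) (j, l)).symm
    have hQ' : Q Xᴴ = (Q X)ᴴ := by
      rw [superoperator_apply Q X, superoperator_apply Q Xᴴ, Finset.sum_comm]
      simp only [conjTranspose_sum, conjTranspose_smul, conjTranspose_apply]
      refine Finset.sum_congr rfl fun i _ => Finset.sum_congr rfl fun j _ => ?_
      rw [hs]
    simp [hQ', depolarizing_apply, maximallyMixed, trace_conjTranspose]
  trace X := by
    simp [hQ.1.2, depolarizing_apply, maximallyMixed_trace]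
  one := by
    have h1 : (1 : Mat2) = (2 : ℂ) • maximallyMixed := by simp [maximallyMixed, smul_smul]
    have h2 : Q 1 = 1 := by rw [h1, map_smul, hQ.2]
    simp [h2, depolarizing_apply, maximallyMixed]

theorem deviation_sub_centre {Q : Superoperator} (hQ : Q ∈ unitalChannels) :
    deviation (choiCoords Q - centre) + depolarizing = Q := by
  have := (isDeviation_of_mem_unitalChannels hQ).deviation_choiCoords
  rw [← choiCoordsLinear_apply, map_sub, choiCoordsLinear_apply, choiCoordsLinear_apply,
    choiCoords_depolarizing] at this
  rw [this, sub_add_cancel]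

theorem deviation_add_mem_unitalChannels {p : Coords} (hp : p ∈ region) :
    deviation p + depolarizing ∈ unitalChannels := by
  refine ⟨⟨hp, fun X => ?_⟩, ?_⟩
  · simp [(isDeviation_deviation p).trace, depolarizing_apply, maximallyMixed_trace]
  · have : deviation p maximallyMixed = 0 := by
      rw [maximallyMixed, map_smul, (isDeviation_deviation p).one, smul_zero]
    simp [this, depolarizing_apply, maximallyMixed_trace]

theorem image_choiCoords_unitalChannels :
    choiCoords '' unitalChannels = (fun p => p - centre) ⁻¹' region := by
  ext p
  constructor
  · rintro ⟨Q, hQ, rfl⟩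
    change IsCompletelyPositive _
    rw [deviation_sub_centre hQ]
    exact hQ.1.1
  · intro hp
    refine ⟨_, deviation_add_mem_unitalChannels hp, ?_⟩
    rw [← choiCoordsLinear_apply, map_add, choiCoordsLinear_apply, choiCoordsLinear_apply,
      choiCoords_depolarizing, choiCoords_deviation, sub_add_cancel]

/-! ### Action of the unitary group -/

theorem mul_conjTranspose_of_mem_unitaryGroup {U : Mat2} (hU : U ∈ unitaryGroup (Fin 2) ℂ) :
    U * Uᴴ = 1 := mem_unitaryGroup_iff.mp hU

theorem conjTranspose_mul_of_mem_unitaryGroup {U : Mat2} (hU : U ∈ unitaryGroup (Fin 2) ℂ) :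
    Uᴴ * U = 1 := mem_unitaryGroup_iff'.mp hU

theorem conjTranspose_mem_unitaryGroup {U : Mat2} (hU : U ∈ unitaryGroup (Fin 2) ℂ) :
    Uᴴ ∈ unitaryGroup (Fin 2) ℂ := by
  rw [mem_unitaryGroup_iff, star_eq_conjTranspose, conjTranspose_conjTranspose]
  exact conjTranspose_mul_of_mem_unitaryGroup hU

theorem conjMap_conjMap_conjTranspose {U : Mat2} (hU : U ∈ unitaryGroup (Fin 2) ℂ) (X : Mat2) :
    conjMap U (conjMap Uᴴ X) = X := by
  have h := mul_conjTranspose_of_mem_unitaryGroup hU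
  simp only [conjMap_apply, conjTranspose_conjTranspose]
  calc U * (Uᴴ * X * U) * Uᴴ = (U * Uᴴ) * X * (U * Uᴴ) := by noncomm_ring
    _ = X := by rw [h, one_mul, mul_one]

theorem conjMap_conjTranspose_conjMap {U : Mat2} (hU : U ∈ unitaryGroup (Fin 2) ℂ) (X : Mat2) :
    conjMap Uᴴ (conjMap U X) = X := by
  have := conjMap_conjMap_conjTranspose (conjTranspose_mem_unitaryGroup hU) X
  rwa [conjTranspose_conjTranspose] at this

theorem trace_conjMap {U : Mat2} (hU : U ∈ unitaryGroup (Fin 2) ℂ) (X : Mat2) :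
    (conjMap U X).trace = X.trace := by
  rw [conjMap_apply, trace_mul_cycle, conjTranspose_mul_of_mem_unitaryGroup hU, one_mul]

theorem conjMap_maximallyMixed {U : Mat2} (hU : U ∈ unitaryGroup (Fin 2) ℂ) :
    conjMap U maximallyMixed = maximallyMixed := by
  simp [maximallyMixed, mul_conjTranspose_of_mem_unitaryGroup hU]

theorem IsDeviation.comp_conjMap {Q : Superoperator} (hQ : IsDeviation Q) {U : Mat2}
    (hU : U ∈ unitaryGroup (Fin 2) ℂ) : IsDeviation (Q ∘ₗ conjMap U) where
  conjTranspose X := by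
    simp only [LinearMap.comp_apply, ← hQ.conjTranspose]
    congr 1
    simp [mul_assoc]
  trace X := hQ.trace _
  one := by
    simp [mul_conjTranspose_of_mem_unitaryGroup hU, hQ.one]

/-- The action on recentred coordinates of the composition with conjugation by `U`. -/
def precomp (U : Mat2) : Coords →ₗ[ℝ] Coords where
  toFun p := choiCoords (deviation p ∘ₗ conjMap U)
  map_add' p q := by
    simp only [← choiCoordsLinear_apply, map_add, LinearMap.add_comp]
  map_smul' r p := by
    simp only [← choiCoordsLinear_apply, map_smul, LinearMap.smul_comp, RingHom.id_apply]

theorem deviation_precomp {U : Mat2} (hU : U ∈ unitaryGroup (Fin 2) ℂ) (p : Coords) :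
    deviation (precomp U p) = deviation p ∘ₗ conjMap U :=
  ((isDeviation_deviation p).comp_conjMap hU).deviation_choiCoords

theorem deviation_injective : Function.Injective deviation :=
  Function.LeftInverse.injective choiCoords_deviation

/-- `precomp U` as a linear equivalence, for a unitary `U`. -/
def precompEquiv {U : Mat2} (hU : U ∈ unitaryGroup (Fin 2) ℂ) : Coords ≃ₗ[ℝ] Coords :=
  LinearEquiv.ofLinearMap (precomp U) (precomp Uᴴ)
    (LinearMap.ext fun p => deviation_injective <| LinearMap.ext fun X => by
      rw [LinearMap.comp_apply, deviation_precomp hU,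
        deviation_precomp (conjTranspose_mem_unitaryGroup hU), LinearMap.comp_apply,
        LinearMap.comp_apply, conjMap_conjTranspose_conjMap hU, LinearMap.id_apply])
    (LinearMap.ext fun p => deviation_injective <| LinearMap.ext fun X => by
      rw [LinearMap.comp_apply, deviation_precomp (conjTranspose_mem_unitaryGroup hU),
        deviation_precomp hU, LinearMap.comp_apply,
        LinearMap.comp_apply, conjMap_conjMap_conjTranspose hU, LinearMap.id_apply])

/-- Conjugation is completely positive, and it preserves the trace, so the depolarizing channel
absorbs it. -/
theorem precomp_mem_region {U : Mat2} (hU : U ∈ unitaryGroup (Fin 2) ℂ) {p : Coords}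
    (hp : p ∈ region) : precomp U p ∈ region := by
  have key : deviation (precomp U p) + depolarizing
      = (deviation p + depolarizing) ∘ₗ conjMap U := by
    rw [deviation_precomp hU, LinearMap.add_comp]
    congr 1
    ext1 X
    rw [LinearMap.comp_apply, depolarizing_apply, depolarizing_apply, trace_conjMap hU]
  change IsCompletelyPositive _
  rw [key]
  exact IsCompletelyPositive.comp hp (isCompletelyPositive_conjMap U)

theorem preimage_precompEquiv_region {U : Mat2} (hU : U ∈ unitaryGroup (Fin 2) ℂ) :
    precompEquiv hU ⁻¹' region = region := by
  ext p
  refine ⟨fun hp => ?_, fun hp => precomp_mem_region hU hp⟩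
  have := precomp_mem_region (conjTranspose_mem_unitaryGroup hU) hp
  rwa [show precomp Uᴴ (precompEquiv hU p) = p from (precompEquiv hU).symm_apply_apply p] at this

/-- The action on the coordinates of the off-diagonal Choi block of conjugation by `U`. -/
def conjOff (U : Mat2) : (ℂ × ℂ × ℂ) →ₗ[ℝ] (ℂ × ℂ × ℂ) where
  toFun q := (conjMap U (offBlock q) 0 0, conjMap U (offBlock q) 0 1, conjMap U (offBlock q) 1 0)
  map_add' p q := by
    have : offBlock (p + q) = offBlock p + offBlock q := by
      ext i j
      fin_cases i <;> fin_cases j <;> simp [offBlock, add_comm]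
    simp only [this, map_add, Matrix.add_apply, Prod.mk_add_mk]
  map_smul' r p := by
    have : offBlock (r • p) = (r : ℂ) • offBlock p := by
      ext i j
      fin_cases i <;> fin_cases j <;> simp [offBlock]
    rw [this, map_smul]
    simp

theorem offBlock_injective : Function.Injective offBlock := by
  intro p q h
  have h00 := congrFun (congrFun h 0) 0
  have h01 := congrFun (congrFun h 0) 1
  have h10 := congrFun (congrFun h 1) 0
  simp [offBlock] at h00 h01 h10
  exact Prod.ext h00 (Prod.ext h01 h10)

theorem offBlock_conjOff {U : Mat2} (hU : U ∈ unitaryGroup (Fin 2) ℂ) (q : ℂ × ℂ × ℂ) :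
    offBlock (conjOff U q) = conjMap U (offBlock q) := by
  have h := trace_conjMap hU (offBlock q)
  rw [Matrix.trace_fin_two, Matrix.trace_fin_two] at h
  have h' : conjMap U (offBlock q) 1 1 = - conjMap U (offBlock q) 0 0 := by
    rw [eq_neg_iff_add_eq_zero, add_comm, h]
    simp [offBlock]
  ext i j
  fin_cases i <;> fin_cases j
  · rfl
  · rfl
  · rfl
  · exact h'.symm

/-- `conjOff U` as a linear equivalence, for a unitary `U`. -/
def conjOffEquiv {U : Mat2} (hU : U ∈ unitaryGroup (Fin 2) ℂ) :
    (ℂ × ℂ × ℂ) ≃ₗ[ℝ] (ℂ × ℂ × ℂ) :=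
  LinearEquiv.ofLinearMap (conjOff U) (conjOff Uᴴ)
    (LinearMap.ext fun q => offBlock_injective <| by
      rw [LinearMap.comp_apply, offBlock_conjOff hU, offBlock_conjOff (conjTranspose_mem_unitaryGroup hU),
        conjMap_conjMap_conjTranspose hU, LinearMap.id_apply])
    (LinearMap.ext fun q => offBlock_injective <| by
      rw [LinearMap.comp_apply, offBlock_conjOff (conjTranspose_mem_unitaryGroup hU), offBlock_conjOff hU,
        conjMap_conjTranspose_conjMap hU, LinearMap.id_apply])

/-- The coordinates of the off-diagonal Choi blocks of the unital channels with given diagonal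
Choi block. -/
def fibre (t : ℝ) (b : ℂ) : Set (ℂ × ℂ × ℂ) := {q | (t, b, q) ∈ region}

/-- Postcomposition with conjugation by `U` conjugates every Choi block and fixes the depolarizing
channel. -/
theorem conjOff_mem_fibre {U : Mat2} (hU : U ∈ unitaryGroup (Fin 2) ℂ) {t t' : ℝ} {b b' : ℂ}
    (h : diagBlock t' b' = conjMap U (diagBlock t b)) {q : ℂ × ℂ × ℂ} (hq : q ∈ fibre t b) :
    conjOff U q ∈ fibre t' b' := by
  have key : deviation (t', b', conjOff U q) + depolarizing
      = conjMap U ∘ₗ (deviation (t, b, q) + depolarizing) := by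
    rw [LinearMap.comp_add]
    congr 1
    · ext1 X
      rw [LinearMap.comp_apply, deviation_apply, deviation_apply, map_add, map_add, map_smul,
        map_smul, map_smul, h, offBlock_conjOff hU]
      congr 2
      simp [mul_assoc]
    · ext1 X
      rw [LinearMap.comp_apply, depolarizing_apply, map_smul, conjMap_maximallyMixed hU]
  change IsCompletelyPositive _
  rw [key]
  exact IsCompletelyPositive.comp (isCompletelyPositive_conjMap U) hq

theorem preimage_conjOffEquiv_fibre {U : Mat2} (hU : U ∈ unitaryGroup (Fin 2) ℂ) {t t' : ℝ}
    {b b' : ℂ} (h : diagBlock t' b' = conjMap U (diagBlock t b)) :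
    conjOffEquiv hU ⁻¹' fibre t' b' = fibre t b := by
  ext q
  refine ⟨fun hq => ?_, fun hq => conjOff_mem_fibre hU h hq⟩
  have h' : diagBlock t b = conjMap Uᴴ (diagBlock t' b') := by
    rw [h, conjMap_conjTranspose_conjMap hU]
  have := conjOff_mem_fibre (conjTranspose_mem_unitaryGroup hU) h' hq
  rwa [show conjOff Uᴴ (conjOffEquiv hU q) = q from (conjOffEquiv hU).symm_apply_apply q] at this

/-! ### Diagonalization -/

/-- The eigenvalues of a traceless Hermitian matrix are `±s`. The determinant is recorded so that
`s²` can be read off without knowing `U`. -/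
theorem exists_unitary_diagBlock {A : Mat2} (hA : A.IsHermitian) (ht : A.trace = 0) :
    ∃ U ∈ unitaryGroup (Fin 2) ℂ, ∃ s : ℝ, A = conjMap U (diagBlock s 0) ∧
      A.det = -(s : ℂ) ^ 2 := by
  have hs := hA.spectral_theorem
  rw [Unitary.conjStarAlgAut_apply] at hs
  have hU : (hA.eigenvectorUnitary : Mat2) ∈ unitaryGroup (Fin 2) ℂ := hA.eigenvectorUnitary.2
  have hsum : hA.eigenvalues 1 = - hA.eigenvalues 0 := by
    have := hA.trace_eq_sum_eigenvalues
    rw [ht, Fin.sum_univ_two] at this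
    have h2 : hA.eigenvalues 0 + hA.eigenvalues 1 = 0 := by 
      apply Complex.ofReal_injective
      push_cast
      exact this.symm
    linarith
  refine ⟨hA.eigenvectorUnitary, hU, hA.eigenvalues 0, ?_, ?_⟩
  · conv_lhs => rw [hs]
    rw [conjMap_apply, star_eq_conjTranspose]
    congr 2
    ext i j
    fin_cases i <;> fin_cases j <;> simp [diagBlock, hsum]
  · rw [hA.det_eq_prod_eigenvalues, Fin.prod_univ_two, hsum]
    push_cast
    simp
    ring

/-! ### Linear maps that preserve a set of positive finite measure -/

/-- The pushforward is `c • μ` with `c = |det|⁻¹`; evaluating on the invariant set `s` forces `c =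
1`. No determinant of a unitary action has to be computed. -/
theorem map_linearEquiv_eq_self {E : Type*} [NormedAddCommGroup E] [NormedSpace ℝ E]
    [FiniteDimensional ℝ E] [MeasurableSpace E] [BorelSpace E] (μ : Measure E)
    [μ.IsAddHaarMeasure] (e : E ≃ₗ[ℝ] E) {s : Set E} (hs : MeasurableSet s) (h : e ⁻¹' s = s)
    (h0 : μ s ≠ 0) (htop : μ s ≠ ⊤) : μ.map e = μ := by
  have hdet : LinearMap.det (e : E →ₗ[ℝ] E) ≠ 0 := e.isUnit_det'.ne_zero
  have hm := Measure.map_linearMap_addHaar_eq_smul_addHaar μ hdet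
  set c := ENNReal.ofReal |(LinearMap.det (e : E →ₗ[ℝ] E))⁻¹|
  have hmeas : Measurable (e : E → E) :=
    (LinearMap.continuous_of_finiteDimensional (e : E →ₗ[ℝ] E)).measurable
  have h1 : c * μ s = μ s := by
    calc c * μ s = (μ.map e) s := by
          rw [show μ.map e = c • μ from hm, Measure.smul_apply, smul_eq_mul]
      _ = μ s := by rw [Measure.map_apply hmeas hs, h]
  have h2 : c = 1 := by
    rw [← ENNReal.mul_left_inj h0 htop, h1, one_mul]
  rw [show μ.map e = c • μ from hm, h2, one_smul]

theorem measure_preimage_linearEquiv {E : Type*} [NormedAddCommGroup E] [NormedSpace ℝ E]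
    [FiniteDimensional ℝ E] [MeasurableSpace E] [BorelSpace E] (μ : Measure E)
    [μ.IsAddHaarMeasure] (e : E ≃ₗ[ℝ] E) {s : Set E} (hs : MeasurableSet s) (h : e ⁻¹' s = s)
    (h0 : μ s ≠ 0) (htop : μ s ≠ ⊤) {t : Set E} (ht : MeasurableSet t) :
    μ (e ⁻¹' t) = μ t := by
  have hmeas : Measurable (e : E → E) :=
    (LinearMap.continuous_of_finiteDimensional (e : E →ₗ[ℝ] E)).measurable
  rw [← Measure.map_apply hmeas ht, map_linearEquiv_eq_self μ e hs h h0 htop]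

/-! ### Topology of the region of unital channels -/

/-- The Choi matrix of the deviation, as a linear map. -/
def choiDeviation : Coords →ₗ[ℝ] Matrix (Fin 2 × Fin 2) (Fin 2 × Fin 2) ℂ where
  toFun p := choi (deviation p)
  map_add' p q := by ext i j; simp [choi]
  map_smul' r p := by ext i j; simp [choi]

theorem choi_depolarizing :
    choi depolarizing = (1 / 2 : ℝ) • (1 : Matrix (Fin 2 × Fin 2) (Fin 2 × Fin 2) ℂ) := by
  ext ⟨i, k⟩ ⟨j, l⟩
  fin_cases i <;> fin_cases j <;> fin_cases k <;> fin_cases l <;>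
    simp [choi, depolarizing_apply, maximallyMixed]

theorem mem_region_iff {p : Coords} :
    p ∈ region ↔ (choiDeviation p + (1 / 2 : ℝ) • (1 : Matrix _ _ ℂ)).PosSemidef := by
  rw [← choi_depolarizing]
  exact isCompletelyPositive_iff

theorem isHermitian_choiDeviation (p : Coords) : (choiDeviation p).IsHermitian := by
  ext ⟨i, k⟩ ⟨j, l⟩
  have h := (isDeviation_deviation p).conjTranspose (Matrix.single j i 1)
  rw [conjTranspose_single, star_one] at h
  exact (congrFun (congrFun h k) l).symm

theorem continuous_choiDeviation : Continuous choiDeviation :=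
  choiDeviation.continuous_of_finiteDimensional

theorem isClosed_region : IsClosed region := by
  have : region = {p | ∀ x : Fin 2 × Fin 2 → ℂ,
      0 ≤ star x ⬝ᵥ (choiDeviation p + (1 / 2 : ℝ) • (1 : Matrix _ _ ℂ)) *ᵥ x} := by
    ext p
    rw [mem_region_iff, posSemidef_iff_dotProduct_mulVec]
    refine and_iff_right ((isHermitian_choiDeviation p).add ?_)
    ext i j
    simp [Matrix.one_apply, apply_ite (starRingEnd ℂ), eq_comm, map_ofNat]
  rw [this, Set.ofPred_forall]
  refine isClosed_iInter fun x => isClosed_le continuous_const ?_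
  have := continuous_choiDeviation
  fun_prop

open scoped MatrixOrder Matrix.Norms.L2Operator in
-- A self-adjoint `A` satisfies `A ≥ -‖A‖`, so `A + 1/2` is positive semidefinite once `‖A‖ < 1/2`.
theorem region_mem_nhds_zero : region ∈ nhds (0 : Coords) := by
  have hc : Continuous fun p => ‖choiDeviation p‖ :=
    (LinearMap.continuous_of_finiteDimensional choiDeviation).norm
  have ho : {p | ‖choiDeviation p‖ < 1 / 2} ∈ nhds (0 : Coords) :=
    (isOpen_lt hc continuous_const).mem_nhds (by simp)
  refine Filter.mem_of_superset ho fun p hp => ?_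
  rw [mem_region_iff, ← Matrix.nonneg_iff_posSemidef]
  have h1 := IsSelfAdjoint.neg_algebraMap_norm_le_self (isHermitian_choiDeviation p).isSelfAdjoint
  rw [neg_le_iff_add_nonneg] at h1
  refine h1.trans ?_
  gcongr
  rw [Algebra.algebraMap_eq_smul_one]
  have : (0 : Matrix (Fin 2 × Fin 2) (Fin 2 × Fin 2) ℂ) ≤ 1 := zero_le_one
  exact smul_le_smul_of_nonneg_right (le_of_lt hp) this

/-- The determinant of the `2 × 2` submatrix on indices `i, j` is nonnegative. -/
theorem normSq_le_of_posSemidef {n : Type*} [Fintype n] {M : Matrix n n ℂ} (h : M.PosSemidef)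
    (i j : n) : Complex.normSq (M i j) ≤ (M i i).re * (M j j).re := by
  have hd := (h.submatrix ![i, j]).det_nonneg
  have hi : ∀ i, (M i i).im = 0 := fun i => Complex.conj_eq_iff_im.mp (h.isHermitian.apply i i)
  have hij : M j i = star (M i j) := (h.isHermitian.apply j i).symm
  rw [det_fin_two] at hd
  have := (Complex.le_def.mp hd).1
  simp [hij, hi] at this
  rw [Complex.normSq_apply]
  linarith

theorem fibre_subset (t : ℝ) (b : ℂ) : fibre t b ⊆
    {q | Complex.normSq q.1 ≤ 1 / 4 - t ^ 2 ∧ Complex.normSq q.2.1 ≤ (1 / 2 + t) ^ 2 ∧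
      Complex.normSq q.2.2 ≤ (1 / 2 - t) ^ 2} := by
  rintro ⟨c, d, e⟩ hq
  have h := mem_region_iff.mp (show (t, b, c, d, e) ∈ region from hq)
  have h1 := normSq_le_of_posSemidef h (0, 0) (1, 0)
  have h2 := normSq_le_of_posSemidef h (0, 0) (1, 1)
  have h3 := normSq_le_of_posSemidef h (0, 1) (1, 0)
  simp [choiDeviation, choi, deviation_apply, diagBlock, offBlock] at h1 h2 h3
  simp
  refine ⟨by linarith, by linarith, by linarith⟩

theorem measurableSet_fibre (t : ℝ) (b : ℂ) : MeasurableSet (fibre t b) :=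
  (isClosed_region.preimage (f := fun q => (t, b, q)) (by fun_prop)).measurableSet

theorem volume_fibre_zero_ne_top : volume (fibre 0 0) ≠ ⊤ := by
  have hb : ∀ z : ℂ, Complex.normSq z ≤ 1 / 4 → ‖z‖ ≤ 1 := by
    intro z hz
    rw [Complex.normSq_eq_norm_sq] at hz
    nlinarith [norm_nonneg z]
  refine ne_top_of_le_ne_top (measure_closedBall_lt_top (μ := volume)
    (x := (0 : ℂ × ℂ × ℂ)) (r := 1)).ne (measure_mono fun q hq => ?_)
  obtain ⟨h1, h2, h3⟩ := fibre_subset 0 0 hq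
  rw [mem_closedBall_zero_iff, Prod.norm_def, Prod.norm_def]
  exact max_le (hb _ (by linarith)) (max_le (hb _ (by linarith)) (hb _ (by linarith)))

theorem volume_fibre_zero_ne_zero : volume (fibre 0 0) ≠ 0 := by
  have hc : Continuous fun q : ℂ × ℂ × ℂ => ((0, 0, q) : Coords) := by fun_prop
  have : fibre 0 0 ∈ nhds (0 : ℂ × ℂ × ℂ) :=
    hc.continuousAt.preimage_mem_nhds region_mem_nhds_zero
  exact (Measure.measure_pos_of_mem_nhds volume this).ne'

/-! ### The volume of the fibres -/

instance : (volume : Measure (ℂ × ℂ)).IsAddHaarMeasure :=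
  inferInstanceAs ((volume : Measure ℂ).prod (volume : Measure ℂ)).IsAddHaarMeasure

instance : (volume : Measure (ℂ × ℂ × ℂ)).IsAddHaarMeasure :=
  inferInstanceAs ((volume : Measure ℂ).prod (volume : Measure (ℂ × ℂ))).IsAddHaarMeasure

/-- Every conjugation fixes the zero block, so `conjOff U` maps `fibre 0 0` onto itself. That set
has positive finite volume, hence `conjOff U` preserves volume on all fibres. -/
theorem volume_fibre_eq_of_conj {U : Mat2} (hU : U ∈ unitaryGroup (Fin 2) ℂ) {t t' : ℝ}
    {b b' : ℂ} (h : diagBlock t' b' = conjMap U (diagBlock t b)) :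
    volume (fibre t' b') = volume (fibre t b) := by
  have h0 : diagBlock 0 0 = conjMap U (diagBlock 0 0) := by
    have : diagBlock 0 0 = 0 := by
      ext i j
      fin_cases i <;> fin_cases j <;> simp [diagBlock]
    rw [this, map_zero]
  rw [← preimage_conjOffEquiv_fibre hU h]
  exact (measure_preimage_linearEquiv volume (conjOffEquiv hU) (measurableSet_fibre 0 0)
    (preimage_conjOffEquiv_fibre hU h0) volume_fibre_zero_ne_zero volume_fibre_zero_ne_top
    (measurableSet_fibre _ _)).symm

theorem volume_preimage_smul_prod {x y z : ℝ} (hx : x ≠ 0) (hy : y ≠ 0) (hz : z ≠ 0)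
    {s : Set (ℂ × ℂ × ℂ)} (hs : MeasurableSet s) :
    volume ((fun q : ℂ × ℂ × ℂ => (x • q.1, y • q.2.1, z • q.2.2)) ⁻¹' s)
      = ENNReal.ofReal ((x * y * z) ^ 2)⁻¹ * volume s := by
  have hm : ∀ {r : ℝ}, r ≠ 0 → (volume : Measure ℂ).map (fun w => r • w)
      = ENNReal.ofReal (r ^ 2)⁻¹ • volume := by
    intro r hr
    rw [Measure.map_addHaar_smul _ hr, Complex.finrank_real_complex, abs_of_nonneg (by positivity)]
  have key : (volume : Measure (ℂ × ℂ × ℂ)).map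
      (fun q : ℂ × ℂ × ℂ => (x • q.1, y • q.2.1, z • q.2.2))
      = ENNReal.ofReal ((x * y * z) ^ 2)⁻¹ • volume := by
    have h1 := Measure.map_prod_map (volume : Measure ℂ) (volume : Measure ℂ)
      (f := fun w => y • w) (g := fun w => z • w) (by fun_prop) (by fun_prop)
    have h2 := Measure.map_prod_map (volume : Measure ℂ) (volume : Measure (ℂ × ℂ))
      (f := fun w => x • w) (g := Prod.map (fun w => y • w) (fun w => z • w))
      (by fun_prop) (by fun_prop)
    rw [Measure.volume_eq_prod] at h2
    rw [← h1, hm hx, hm hy, hm hz] at h2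
    rw [Measure.volume_eq_prod, Measure.volume_eq_prod]
    refine h2.symm.trans ?_
    simp only [Measure.prod_smul_left, Measure.prod_smul_right, smul_smul]
    rw [← ENNReal.ofReal_mul (by positivity), ← ENNReal.ofReal_mul (by positivity)]
    congr 2
    field_simp
  rw [← Measure.map_apply (by fun_prop) hs, key, Measure.smul_apply, smul_eq_mul]

theorem preimage_smul_fibre {t : ℝ} (h1 : 0 < 1 / 2 + t) (h2 : 0 < 1 / 2 - t) :
    (fun q : ℂ × ℂ × ℂ => (√((1 + 2 * t) * (1 - 2 * t)) • q.1, (1 + 2 * t) • q.2.1,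
      (1 - 2 * t) • q.2.2)) ⁻¹' fibre t 0 = fibre 0 0 := by
  have hx : 0 < 1 + 2 * t := by linarith
  have hy : 0 < 1 - 2 * t := by linarith
  -- The Choi diagonal over `(t, 0)` is `1/2 ± t`, with `+` exactly when the two indices agree.
  -- Congruence by `D` produces it from the constant diagonal `1/2`, keeps the zero entries zero,
  -- and scales `c`, `d`, `e` by the stated factors.
  set D : Matrix (Fin 2 × Fin 2) (Fin 2 × Fin 2) ℂ :=
    diagonal fun p => if p.1 = p.2 then (√(1 + 2 * t) : ℂ) else (√(1 - 2 * t) : ℂ) with hD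
  have hDu : IsUnit D := by
    rw [Matrix.isUnit_iff_isUnit_det, hD, det_diagonal, isUnit_iff_ne_zero,
      Finset.prod_ne_zero_iff]
    intro p _
    have := (Real.sqrt_pos.mpr hx).ne'
    have := (Real.sqrt_pos.mpr hy).ne'
    split_ifs <;> simpa
  have hxx : (√(1 + 2 * t) : ℂ) * √(1 + 2 * t) = 1 + 2 * t := by
    rw [← Complex.ofReal_mul, Real.mul_self_sqrt hx.le]
    push_cast
    ring
  have hyy : (√(1 - 2 * t) : ℂ) * √(1 - 2 * t) = 1 - 2 * t := by
    rw [← Complex.ofReal_mul, Real.mul_self_sqrt hy.le]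
    push_cast
    ring
  ext ⟨c, d, e⟩
  have e1 : (c, d, e) ∈ fibre 0 0 ↔
      (choiDeviation (0, 0, c, d, e) + (1 / 2 : ℝ) • (1 : Matrix _ _ ℂ)).PosSemidef :=
    mem_region_iff
  have e2 : (√((1 + 2 * t) * (1 - 2 * t)) • c, (1 + 2 * t) • d, (1 - 2 * t) • e) ∈ fibre t 0 ↔
      (choiDeviation (t, 0, √((1 + 2 * t) * (1 - 2 * t)) • c, (1 + 2 * t) • d, (1 - 2 * t) • e)
        + (1 / 2 : ℝ) • (1 : Matrix _ _ ℂ)).PosSemidef :=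
    mem_region_iff
  rw [Set.mem_preimage, e1, e2]
  refine Iff.trans ?_ hDu.posSemidef_star_left_conjugate_iff
  congr! 1
  rw [Real.sqrt_mul hx.le]
  ext ⟨i, k⟩ ⟨j, l⟩
  rw [hD, star_eq_conjTranspose, diagonal_conjTranspose, mul_diagonal, diagonal_mul]
  fin_cases i <;> fin_cases k <;> fin_cases j <;> fin_cases l <;>
    simp [choiDeviation, choi, deviation_apply, diagBlock, offBlock, map_ofNat] <;>
    first
    | ring1
    | linear_combination (-1 / 2 : ℂ) * hxx
    | linear_combination (-1 / 2 : ℂ) * hyy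
    | linear_combination (-d) * hxx
    | linear_combination (-e) * hyy
    | linear_combination (-starRingEnd ℂ d) * hxx
    | linear_combination (-starRingEnd ℂ e) * hyy

theorem volume_fibre_diagonal (t : ℝ) :
    volume (fibre t 0) = ENNReal.ofReal (1 - 4 * t ^ 2) ^ 3 * volume (fibre 0 0) := by
  by_cases ht : 1 - 4 * t ^ 2 ≤ 0
  -- For `|t| ≥ 1/2` the minor bound `|c|² ≤ 1/4 - t²` forces `c = 0`, so the fibre is null,
  -- matching the truncation by `ENNReal.ofReal`.
  · rw [ENNReal.ofReal_of_nonpos ht, zero_pow (by norm_num), zero_mul]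
    have hs : fibre t 0 ⊆ ({0} : Set ℂ) ×ˢ Set.univ := by
      intro q hq
      have := (fibre_subset t 0 hq).1
      have h0 : Complex.normSq q.1 = 0 :=
        le_antisymm (by linarith) (Complex.normSq_nonneg _)
      simpa using Complex.normSq_eq_zero.mp h0
    refine measure_mono_null hs ?_
    rw [Measure.volume_eq_prod, Measure.prod_prod]
    simp
  · have h1 : 0 < 1 / 2 + t := by nlinarith
    have h2 : 0 < 1 / 2 - t := by nlinarith
    have hx : 0 < 1 + 2 * t := by linarith
    have hy : 0 < 1 - 2 * t := by linarith
    have hs : 0 < √((1 + 2 * t) * (1 - 2 * t)) := Real.sqrt_pos.mpr (mul_pos hx hy)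
    have h := volume_preimage_smul_prod hs.ne' hx.ne' hy.ne' (measurableSet_fibre t 0)
    rw [preimage_smul_fibre h1 h2] at h
    -- The square is there because each scaled coordinate is complex, hence of real dimension two.
    have e : (√((1 + 2 * t) * (1 - 2 * t)) * (1 + 2 * t) * (1 - 2 * t)) ^ 2
        = (1 - 4 * t ^ 2) ^ 3 := by
      rw [mul_pow, mul_pow, Real.sq_sqrt (by positivity)]
      ring
    rw [h, e, ← mul_assoc, ← ENNReal.ofReal_pow (by linarith), ← ENNReal.ofReal_mul,
      mul_inv_cancel₀, ENNReal.ofReal_one, one_mul]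
    · have : 0 < 1 - 4 * t ^ 2 := by linarith
      positivity
    · have : 0 < 1 - 4 * t ^ 2 := by linarith
      positivity

theorem isHermitian_diagBlock (t : ℝ) (b : ℂ) : (diagBlock t b).IsHermitian := by
  ext i j
  fin_cases i <;> fin_cases j <;> simp [diagBlock]

theorem det_diagBlock (t : ℝ) (b : ℂ) : (diagBlock t b).det = -(t ^ 2 + ‖b‖ ^ 2 : ℂ) := by
  simp [diagBlock, det_fin_two, Complex.mul_conj']
  ring

theorem volume_fibre (t : ℝ) (b : ℂ) :
    volume (fibre t b)
      = ENNReal.ofReal (1 - 4 * (t ^ 2 + ‖b‖ ^ 2)) ^ 3 * volume (fibre 0 0) := by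
  obtain ⟨U, hU, s, h, hdet⟩ := exists_unitary_diagBlock (isHermitian_diagBlock t b)
    (by simp [diagBlock, Matrix.trace_fin_two])
  have hs : t ^ 2 + ‖b‖ ^ 2 = s ^ 2 := by
    apply Complex.ofReal_injective
    rw [det_diagBlock] at hdet
    push_cast
    linear_combination -hdet
  rw [volume_fibre_eq_of_conj hU h, volume_fibre_diagonal, hs]

end Qubit

/-- Integration of a radial function in polar coordinates. -/
theorem MeasureTheory.lintegral_fun_norm_addHaar {E : Type*} [NormedAddCommGroup E]
    [NormedSpace ℝ E] [Nontrivial E] [FiniteDimensional ℝ E] [MeasurableSpace E] [BorelSpace E]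
    (μ : Measure E) [μ.IsAddHaarMeasure] {f : ℝ → ENNReal} (hf : Measurable f) :
    ∫⁻ x, f ‖x‖ ∂μ = μ.toSphere Set.univ *
      ∫⁻ r in Set.Ioi (0 : ℝ), ENNReal.ofReal (r ^ (Module.finrank ℝ E - 1)) * f r := by
  have h := μ.measurePreserving_homeomorphUnitSphereProd
  have hc : MeasurableSet ({0}ᶜ : Set E) := (measurableSet_singleton 0).compl
  calc ∫⁻ x, f ‖x‖ ∂μ = ∫⁻ x in ({0}ᶜ : Set E), f ‖x‖ ∂μ := by
        rw [restrict_compl_singleton]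
    _ = ∫⁻ x : ({0}ᶜ : Set E), f ‖x.1‖ ∂(μ.comap (↑)) :=
        (lintegral_subtype_comap hc fun x => f ‖x‖).symm
    _ = ∫⁻ z, f z.2 ∂(μ.toSphere.prod (.volumeIoiPow (Module.finrank ℝ E - 1))) := by
        rw [← h.lintegral_comp (by fun_prop)]
        simp
    _ = μ.toSphere Set.univ * ∫⁻ r, f r ∂(Measure.volumeIoiPow (Module.finrank ℝ E - 1)) := by
        rw [lintegral_prod _ (by fun_prop)]
        dsimp only
        rw [lintegral_const, mul_comm]
    _ = _ := by
        rw [Measure.volumeIoiPow, lintegral_withDensity_eq_lintegral_mul _ (by fun_prop)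
          (by fun_prop)]
        congr 1
        exact lintegral_subtype_comap measurableSet_Ioi
          fun r : ℝ => ENNReal.ofReal (r ^ (Module.finrank ℝ E - 1)) * f r

namespace Qubit

open Matrix

/-! ### Bloch radii -/

/-- The Bloch vector is `2s (Re b, Im b, t)`; the maximally mixed part contributes nothing since the
Pauli matrices are traceless. -/
theorem blochRadius_maximallyMixed_add (s t : ℝ) (b : ℂ) :
    blochRadius (maximallyMixed + (s : ℂ) • diagBlock t b) = |s| * (2 * √(t ^ 2 + ‖b‖ ^ 2)) := by
  have h : ‖blochVector (maximallyMixed + (s : ℂ) • diagBlock t b)‖ ^ 2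
      = (|s| * (2 * √(t ^ 2 + ‖b‖ ^ 2))) ^ 2 := by
    rw [EuclideanSpace.norm_sq_eq, mul_pow, mul_pow, Real.sq_sqrt (by positivity), sq_abs,
      ← Complex.normSq_eq_norm_sq, Complex.normSq_apply]
    simp [Fin.sum_univ_succ, blochVector, maximallyMixed, diagBlock, pauli, Matrix.trace,
      Matrix.mul_apply, sq_abs]
    ring
  exact (pow_left_inj₀ (norm_nonneg _) (by positivity) two_ne_zero).mp h

theorem eq_diagBlock {A : Mat2} (hA : A.IsHermitian) (ht : A.trace = 0) :
    A = diagBlock (A 0 0).re (A 0 1) := by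
  have h00 : ((A 0 0).re : ℂ) = A 0 0 := Complex.conj_eq_iff_re.mp (hA.apply 0 0)
  have h10 : star (A 0 1) = A 1 0 := hA.apply 1 0
  rw [Matrix.trace_fin_two] at ht
  rw [diagBlock, h00, h10, ← eq_neg_of_add_eq_zero_right ht]
  exact eta_fin_two A

theorem exists_unitary_of_isState {ρ : Mat2} (hρ : IsState ρ) :
    ∃ U ∈ unitaryGroup (Fin 2) ℂ, ∃ s : ℝ, ρ = maximallyMixed + conjMap U (diagBlock s 0) ∧
      blochRadius ρ = 2 * |s| := by
  have hm : maximallyMixed.IsHermitian := by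
    ext i j
    fin_cases i <;> fin_cases j <;> simp [maximallyMixed]
  obtain ⟨U, hU, s, h, hdet⟩ := exists_unitary_diagBlock (hρ.1.isHermitian.sub hm)
    (by rw [trace_sub, hρ.2, maximallyMixed_trace, sub_self])
  refine ⟨U, hU, s, by rw [← h, add_sub_cancel], ?_⟩
  have hA := eq_diagBlock (hρ.1.isHermitian.sub hm)
    (by rw [trace_sub, hρ.2, maximallyMixed_trace, sub_self])
  set t := ((ρ - maximallyMixed) 0 0).re
  set b := (ρ - maximallyMixed) 0 1
  rw [hA, det_diagBlock] at hdet
  have hs : t ^ 2 + ‖b‖ ^ 2 = s ^ 2 := by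
    apply Complex.ofReal_injective
    push_cast
    linear_combination -hdet
  have hr := blochRadius_maximallyMixed_add 1 t b
  rwa [Complex.ofReal_one, one_smul, ← hA, add_sub_cancel, hs, Real.sqrt_sq_eq_abs, abs_one,
    one_mul] at hr

/-- `r₀` times the Bloch radius of the image of `E₁₁` under a unital channel, as a function of
the first two recentred coordinates `(t, b)` of that channel. -/
def scaledRadius (r₀ : ℝ) (z : ℝ × ℂ) : ℝ := r₀ * (2 * √(z.1 ^ 2 + ‖z.2‖ ^ 2))

/-- The matrix `diag(s, -s)` has no off-diagonal entries and trace zero, so after absorbing `U` into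
the channel only the diagonal Choi block acts on it, with factor `2s`. -/
theorem blochRadius_apply_eq {Q : Superoperator} (hQ : Q ∈ unitalChannels) {U : Mat2}
    (hU : U ∈ unitaryGroup (Fin 2) ℂ) (s : ℝ) :
    blochRadius (Q (maximallyMixed + conjMap U (diagBlock s 0)))
      = scaledRadius (2 * |s|) ((precomp U (choiCoords Q - centre)).1,
          (precomp U (choiCoords Q - centre)).2.1) := by
  have h1 : Q (conjMap U (diagBlock s 0)) = ((2 * s : ℝ) : ℂ) • diagBlock
      (precomp U (choiCoords Q - centre)).1 (precomp U (choiCoords Q - centre)).2.1 := by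
    conv_lhs => rw [← deviation_sub_centre hQ]
    rw [LinearMap.add_apply, ← LinearMap.comp_apply, ← deviation_precomp hU, deviation_apply,
      depolarizing_apply, trace_conjMap hU]
    simp [diagBlock, Matrix.trace_fin_two, -smul_of, two_mul]
  rw [map_add, hQ.2, h1, blochRadius_maximallyMixed_add, scaledRadius, abs_mul,
    abs_of_pos (zero_lt_two' ℝ)]

/-! ### The law of the Bloch radius -/

theorem measurable_scaledRadius (r₀ : ℝ) : Measurable (scaledRadius r₀) := by
  unfold scaledRadius
  fun_prop

/-- Fubini over `(t, b)`, with `volume_fibre` as the inner integral. -/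
theorem volume_region_inter {s : Set (ℝ × ℂ)} (hs : MeasurableSet s) :
    volume (region ∩ {p | (p.1, p.2.1) ∈ s})
      = volume (fibre 0 0) *
        ∫⁻ z in s, ENNReal.ofReal (1 - 4 * (z.1 ^ 2 + ‖z.2‖ ^ 2)) ^ 3 := by
  have hm : MeasurableSet (region ∩ {p | (p.1, p.2.1) ∈ s}) :=
    isClosed_region.measurableSet.inter (hs.preimage (by fun_prop))
  have hf : Measurable fun z : ℝ × ℂ => ENNReal.ofReal (1 - 4 * (z.1 ^ 2 + ‖z.2‖ ^ 2)) ^ 3 := by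
    fun_prop
  rw [Measure.volume_eq_prod, Measure.prod_apply hm, ← lintegral_indicator hs,
    Measure.volume_eq_prod ℝ ℂ, lintegral_prod _ (hf.indicator hs).aemeasurable,
    ← lintegral_const_mul _ (hf.indicator hs).lintegral_prod_right']
  refine lintegral_congr fun t => ?_
  rw [Measure.volume_eq_prod ℂ, Measure.prod_apply (hm.preimage (by fun_prop)),
    ← lintegral_const_mul _ (show Measurable fun b => s.indicator _ (t, b) from
      (hf.indicator hs).comp measurable_prodMk_left)]
  refine lintegral_congr fun b => ?_
  by_cases h : (t, b) ∈ s
  · rw [Set.indicator_of_mem h, mul_comm, ← volume_fibre]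
    congr 1
    ext q
    simp [h, fibre]
  · rw [Set.indicator_of_notMem h, mul_zero]
    convert measure_empty (μ := (volume : Measure (ℂ × ℂ × ℂ)))
    ext q
    simp [h]

/-- The linear equivalence of `ℝ × ℂ` with a Euclidean space whose norm is `scaledRadius r₀`. -/
def radiusEquiv {r₀ : ℝ} (hr₀ : 0 < r₀) : (ℝ × ℂ) ≃L[ℝ] WithLp 2 (ℝ × ℂ) :=
  (WithLp.prodContinuousLinearEquiv 2 ℝ ℝ ℂ).symm.trans
    (ContinuousLinearEquiv.smulLeft (Units.mk0 (2 * r₀) (by positivity)))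

theorem norm_radiusEquiv {r₀ : ℝ} (hr₀ : 0 < r₀) (z : ℝ × ℂ) :
    ‖radiusEquiv hr₀ z‖ = scaledRadius r₀ z := by
  have : radiusEquiv hr₀ z = (2 * r₀) • WithLp.toLp 2 z := rfl
  rw [this, norm_smul, WithLp.prod_norm_eq_of_L2, Real.norm_of_nonneg (by positivity),
    scaledRadius]
  simp
  ring

theorem ofReal_mul_eq_kappaOne {r₀ r : ℝ} (hr₀ : 0 < r₀) (hr : 0 < r) :
    ENNReal.ofReal (r ^ 2) * ENNReal.ofReal (1 - (r / r₀) ^ 2) ^ 3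
      = ENNReal.ofReal (16 * r₀ ^ 3 / 315) * ENNReal.ofReal (kappaOne r r₀) := by
  by_cases h : r ≤ r₀
  · have h1 : 0 ≤ 1 - (r / r₀) ^ 2 := by
      have : r / r₀ ≤ 1 := (div_le_one hr₀).mpr h
      have : 0 ≤ r / r₀ := by positivity
      nlinarith
    rw [kappaOne, Set.indicator_of_mem (show r ∈ Set.Icc 0 r₀ from ⟨hr.le, h⟩),
      ← ENNReal.ofReal_pow h1, ← ENNReal.ofReal_mul (by positivity),
      ← ENNReal.ofReal_mul (by positivity)]
    congr 1
    field_simp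
  · rw [kappaOne, Set.indicator_of_notMem (fun h' => h h'.2), ENNReal.ofReal_zero, mul_zero,
      ENNReal.ofReal_of_nonpos (p := 1 - _), zero_pow (by norm_num), mul_zero]
    have : 1 ≤ r / r₀ := (one_le_div hr₀).mpr (not_le.mp h).le
    nlinarith

theorem measurable_kappaOne (r₀ : ℝ) : Measurable fun r => kappaOne r r₀ := by
  unfold kappaOne
  exact Measurable.indicator (by fun_prop) measurableSet_Icc

/-- Restricting to the half-line of polar coordinates loses nothing, since `kappaOne` vanishes for
`r ≤ 0`. -/
theorem setLIntegral_Ioi_kappaOne (r₀ : ℝ) {s : Set ℝ} (hs : MeasurableSet s) :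
    ∫⁻ r in Set.Ioi 0, s.indicator (fun r => ENNReal.ofReal (kappaOne r r₀)) r
      = (volume.withDensity fun r => ENNReal.ofReal (kappaOne r r₀)) s := by
  rw [withDensity_apply _ hs, ← lintegral_indicator hs, ← lintegral_indicator measurableSet_Ioi]
  refine lintegral_congr fun r => ?_
  by_cases hr : r ∈ Set.Ioi (0 : ℝ)
  · rw [Set.indicator_of_mem hr]
  · rw [Set.indicator_of_notMem hr]
    have h0 : kappaOne r r₀ = 0 := by
      rw [kappaOne, Set.indicator_apply_eq_zero]
      intro h
      have : r = 0 := le_antisymm (not_lt.mp hr) h.1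
      simp [this]
    by_cases h : r ∈ s <;> simp [h, h0]

theorem exists_volume_region_inter_eq {r₀ : ℝ} (hr₀ : 0 < r₀) :
    ∃ C : ENNReal, ∀ s : Set ℝ, MeasurableSet s →
      volume (region ∩ {p | scaledRadius r₀ (p.1, p.2.1) ∈ s})
        = C * (volume.withDensity fun r => ENNReal.ofReal (kappaOne r r₀)) s := by
  -- After transport to a three-dimensional Euclidean space whose norm is the scaled radius, the
  -- density is `(1 - (‖y‖ / r₀)²)³`, truncated at zero, so radial integration applies.
  set μ := (volume : Measure (ℝ × ℂ)).map (radiusEquiv hr₀) with hμ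
  have : (volume : Measure (ℝ × ℂ)).IsAddHaarMeasure :=
    inferInstanceAs ((volume : Measure ℝ).prod (volume : Measure ℂ)).IsAddHaarMeasure
  have : μ.IsAddHaarMeasure := (radiusEquiv hr₀).isAddHaarMeasure_map volume
  have hdim : Module.finrank ℝ (WithLp 2 (ℝ × ℂ)) = 3 := by
    rw [← (radiusEquiv hr₀).toLinearEquiv.finrank_eq]
    simp
  have : Nontrivial (WithLp 2 (ℝ × ℂ)) := (radiusEquiv hr₀).symm.toEquiv.nontrivial
  have : FiniteDimensional ℝ (WithLp 2 (ℝ × ℂ)) :=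
    (radiusEquiv hr₀).toLinearEquiv.finiteDimensional
  refine ⟨volume (fibre 0 0) * (μ.toSphere Set.univ * ENNReal.ofReal (16 * r₀ ^ 3 / 315)),
    fun s hs => ?_⟩
  set f : ℝ → ENNReal := s.indicator fun r => ENNReal.ofReal (1 - (r / r₀) ^ 2) ^ 3 with hf
  have hfm : Measurable f := Measurable.indicator (by fun_prop) hs
  have hS := hs.preimage (measurable_scaledRadius r₀)
  have h1 : ∫⁻ z in scaledRadius r₀ ⁻¹' s, ENNReal.ofReal (1 - 4 * (z.1 ^ 2 + ‖z.2‖ ^ 2)) ^ 3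
      = ∫⁻ y, f ‖y‖ ∂μ := by
    rw [hμ, lintegral_map (by fun_prop) (radiusEquiv hr₀).continuous.measurable,
      ← lintegral_indicator hS]
    refine lintegral_congr fun z => ?_
    have : 4 * (z.1 ^ 2 + ‖z.2‖ ^ 2) = (scaledRadius r₀ z / r₀) ^ 2 := by
      rw [scaledRadius, mul_div_cancel_left₀ _ hr₀.ne', mul_pow, Real.sq_sqrt (by positivity)]
      norm_num
    rw [norm_radiusEquiv]
    by_cases h : scaledRadius r₀ z ∈ s
    · rw [hf, Set.indicator_of_mem h, Set.indicator_of_mem (show z ∈ scaledRadius r₀ ⁻¹' s from h),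
        this]
    · rw [hf, Set.indicator_of_notMem h,
        Set.indicator_of_notMem (show z ∉ scaledRadius r₀ ⁻¹' s from h)]
  have h2 := volume_region_inter hS
  rw [h1, lintegral_fun_norm_addHaar μ hfm, hdim] at h2
  refine h2.trans ?_
  rw [mul_assoc, mul_assoc, ← setLIntegral_Ioi_kappaOne r₀ hs,
    ← lintegral_const_mul _ ((measurable_kappaOne r₀).ennreal_ofReal.indicator hs)]
  congr 2
  refine setLIntegral_congr_fun measurableSet_Ioi fun r hr => ?_
  by_cases h : r ∈ s
  · simp only [hf, Set.indicator_of_mem h]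
    exact ofReal_mul_eq_kappaOne hr₀ hr
  · simp only [hf, Set.indicator_of_notMem h, mul_zero]

theorem isProbabilityMeasure_kappaOne {r₀ : ℝ} (hr₀ : 0 < r₀) :
    IsProbabilityMeasure (volume.withDensity fun r => ENNReal.ofReal (kappaOne r r₀)) := by
  constructor
  rw [withDensity_apply _ MeasurableSet.univ, Measure.restrict_univ]
  have h : (fun r => ENNReal.ofReal (kappaOne r r₀)) = (Set.Icc 0 r₀).indicator
      fun r => ENNReal.ofReal (315 / 16 * (r ^ 2 * (r₀ ^ 2 - r ^ 2) ^ 3 / r₀ ^ 9)) := by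
    ext r
    by_cases h : r ∈ Set.Icc 0 r₀ <;> simp [kappaOne, h]
  have hi : ∫ r in (0 : ℝ)..r₀, 315 / 16 * (r ^ 2 * (r₀ ^ 2 - r ^ 2) ^ 3 / r₀ ^ 9) = 1 := by
    -- Antiderivative from expanding the cube; at `r₀` the bracket is `r₀⁹ (1/3 - 3/5 + 3/7 - 1/9) =
    -- 16 r₀⁹ / 315`.
    have hd : ∀ x ∈ Set.uIcc 0 r₀, HasDerivAt
        (fun r => 315 / 16 * ((r₀ ^ 6 * r ^ 3 / 3 - 3 * r₀ ^ 4 * r ^ 5 / 5 + 3 * r₀ ^ 2 * r ^ 7 / 7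
          - r ^ 9 / 9) / r₀ ^ 9))
        (315 / 16 * (x ^ 2 * (r₀ ^ 2 - x ^ 2) ^ 3 / r₀ ^ 9)) x := by
      intro x _
      have h3 := ((hasDerivAt_pow 3 x).const_mul (r₀ ^ 6)).div_const 3
      have h5 := ((hasDerivAt_pow 5 x).const_mul (3 * r₀ ^ 4)).div_const 5
      have h7 := ((hasDerivAt_pow 7 x).const_mul (3 * r₀ ^ 2)).div_const 7
      have h9 := (hasDerivAt_pow 9 x).div_const 9
      refine ((((h3.sub h5).add h7).sub h9).div_const (r₀ ^ 9)).const_mul (315 / 16)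
        |>.congr_deriv ?_
      push_cast
      ring
    rw [intervalIntegral.integral_eq_sub_of_hasDerivAt hd
      (Continuous.intervalIntegrable (by fun_prop) _ _)]
    field_simp
    ring
  rw [h, lintegral_indicator measurableSet_Icc, ← ofReal_integral_eq_lintegral_ofReal,
    integral_Icc_eq_integral_Ioc, ← intervalIntegral.integral_of_le hr₀.le, hi, ENNReal.ofReal_one]
  · exact (Continuous.continuousOn (by fun_prop)).integrableOn_Icc
  · refine (ae_restrict_mem measurableSet_Icc).mono fun r hr => ?_
    have : 0 ≤ r₀ ^ 2 - r ^ 2 := by nlinarith [hr.1, hr.2]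
    positivity

instance : (volume : Measure (ℂ × ℂ × ℂ × ℂ)).IsAddHaarMeasure :=
  Measure.prod.instIsAddHaarMeasure (volume : Measure ℂ) (volume : Measure (ℂ × ℂ × ℂ))

instance : (volume : Measure Coords).IsAddHaarMeasure :=
  Measure.prod.instIsAddHaarMeasure (volume : Measure ℝ) (volume : Measure (ℂ × ℂ × ℂ × ℂ))

theorem volume_region_ne_zero : volume region ≠ 0 :=
  (Measure.measure_pos_of_mem_nhds volume region_mem_nhds_zero).ne'

theorem volume_region_ne_top : volume region ≠ ⊤ := by
  refine ne_top_of_le_ne_top (measure_closedBall_lt_top (μ := volume)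
    (x := (0 : Coords)) (r := 1)).ne (measure_mono ?_)
  rintro ⟨t, b, q⟩ hp
  have hb : ∀ z : ℂ, Complex.normSq z ≤ 1 → ‖z‖ ≤ 1 := by
    intro z hz
    rw [Complex.normSq_eq_norm_sq] at hz
    nlinarith [norm_nonneg z]
  obtain ⟨h1, h2, h3⟩ := fibre_subset t b (show q ∈ fibre t b from hp)
  have h4 := normSq_le_of_posSemidef (mem_region_iff.mp hp) (0, 0) (0, 1)
  simp [choiDeviation, choi, deviation_apply, diagBlock, offBlock] at h4
  have h5 := Complex.normSq_nonneg q.1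
  -- From `0 ≤ |c|² ≤ 1/4 - t²`; the minors then put the other coordinates in the unit ball.
  have ht : |t| ≤ 1 / 2 := abs_le_of_sq_le_sq (by linarith) (by norm_num)
  rw [abs_le] at ht
  rw [mem_closedBall_zero_iff, Prod.norm_def, Prod.norm_def, Prod.norm_def, Prod.norm_def]
  refine max_le ?_ (max_le (hb _ ?_) (max_le (hb _ ?_) (max_le (hb _ ?_) (hb _ ?_))))
  · rw [Real.norm_eq_abs, abs_le]
    constructor <;> linarith
  all_goals nlinarith

theorem ae_eq_scaledRadius {Ω : Type*} [MeasurableSpace Ω] {P : Measure Ω}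
    {Q : Ω → Superoperator} (hQ : ∀ᵐ ω ∂P, Q ω ∈ unitalChannels) {U : Mat2}
    (hU : U ∈ unitaryGroup (Fin 2) ℂ) (s : ℝ) :
    (fun ω => blochRadius (Q ω (maximallyMixed + conjMap U (diagBlock s 0)))) =ᵐ[P]
      (fun p => scaledRadius (2 * |s|) ((precomp U (p - centre)).1,
        (precomp U (p - centre)).2.1)) ∘ fun ω => choiCoords (Q ω) :=
  hQ.mono fun _ h => blochRadius_apply_eq h hU s

/-- Translation by `centre` and `precomp U` both preserve Lebesgue measure, and together they carry
the coordinates of the unital channels onto `region`. -/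
theorem measure_image_preimage_scaledRadius {U : Mat2} (hU : U ∈ unitaryGroup (Fin 2) ℂ)
    (r₀ : ℝ) {s : Set ℝ} (hs : MeasurableSet s) :
    volume ((choiCoords '' unitalChannels) ∩ (fun p : Coords => scaledRadius r₀
        ((precomp U (p - centre)).1, (precomp U (p - centre)).2.1)) ⁻¹' s)
      = volume (region ∩ {p | scaledRadius r₀ (p.1, p.2.1) ∈ s}) := by
  have hm : MeasurableSet (region ∩ {p | scaledRadius r₀ (p.1, p.2.1) ∈ s}) :=
    isClosed_region.measurableSet.inter
      (hs.preimage ((measurable_scaledRadius r₀).comp (by fun_prop)))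
  have he : Measurable (precompEquiv hU) :=
    (precomp U).continuous_of_finiteDimensional.measurable
  rw [← measure_preimage_linearEquiv volume (precompEquiv hU) isClosed_region.measurableSet
    (preimage_precompEquiv_region hU) volume_region_ne_zero volume_region_ne_top hm,
    ← (measurePreserving_sub_right volume centre).measure_preimage
      (hm.preimage he).nullMeasurableSet, Set.preimage_inter,
    preimage_precompEquiv_region, image_choiCoords_unitalChannels]
  rfl

end Qubit

theorem mainTheorem4 {Ω : Type*} [MeasurableSpace Ω] (P : Measure Ω) [IsProbabilityMeasure P]
    (Q : Ω → Qubit.Superoperator) (hQ : Qubit.IsUniformUnitalChannel P Q)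
    (ρ : Qubit.Mat2) (hρ : Qubit.IsState ρ)
    (r₀ : ℝ) (hr₀ : 0 < r₀) (hρr : Qubit.blochRadius ρ = r₀) :
    HasLaw (fun ω => Qubit.blochRadius (Q ω ρ))
      (volume.withDensity fun r => ENNReal.ofReal (Qubit.kappaOne r r₀)) P := by
  obtain ⟨U, hU, s, hρU, hs⟩ := Qubit.exists_unitary_of_isState hρ
  rw [hρr] at hs
  have hae := Qubit.ae_eq_scaledRadius hQ.1 hU s
  rw [← hρU, ← hs] at hae
  set g : Qubit.Coords → ℝ := fun p => Qubit.scaledRadius r₀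
    ((Qubit.precomp U (p - Qubit.centre)).1, (Qubit.precomp U (p - Qubit.centre)).2.1) with hg
  have hgm : Measurable g := by
    have hp := (Qubit.precomp U).continuous_of_finiteDimensional.measurable.comp
      (measurable_id.sub_const Qubit.centre)
    exact (Qubit.measurable_scaledRadius r₀).comp (hp.fst.prodMk hp.snd.fst)
  have hvol : volume (Qubit.choiCoords '' Qubit.unitalChannels) = volume Qubit.region := by
    rw [Qubit.image_choiCoords_unitalChannels,
      (measurePreserving_sub_right volume Qubit.centre).measure_preimage
        Qubit.isClosed_region.measurableSet.nullMeasurableSet]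
  -- No measurability of `Q` is assumed: the pushforward along a map that is not a.e. measurable is
  -- zero, which a uniform law is not.
  have hX := pdf.IsUniform.aemeasurable (by rw [hvol]; exact Qubit.volume_region_ne_zero)
    (by rw [hvol]; exact Qubit.volume_region_ne_top) hQ.2
  have hR := (hgm.comp_aemeasurable hX).congr hae.symm
  refine ⟨hR, ?_⟩
  obtain ⟨C, hC⟩ := Qubit.exists_volume_region_inter_eq hr₀
  have hK : MeasurableSet (Qubit.choiCoords '' Qubit.unitalChannels) := by
    rw [Qubit.image_choiCoords_unitalChannels]
    exact Qubit.isClosed_region.measurableSet.preimage (by fun_prop)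
  have hmap : P.map (fun ω => Qubit.blochRadius (Q ω ρ)) = ((volume Qubit.region)⁻¹ * C) •
      volume.withDensity fun r => ENNReal.ofReal (Qubit.kappaOne r r₀) := by
    ext A hA
    rw [Measure.map_congr hae, ← AEMeasurable.map_map_of_aemeasurable hgm.aemeasurable hX,
      Measure.map_apply hgm hA, hQ.2, cond_apply hK, hvol,
      Qubit.measure_image_preimage_scaledRadius hU r₀ hA, hC A hA, Measure.smul_apply,
      smul_eq_mul, mul_assoc]
  have := Measure.isProbabilityMeasure_map (μ := P) hR
  have := Qubit.isProbabilityMeasure_kappaOne hr₀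
  -- Both measures have total mass one, so the unknown constant is one.
  have h1 := congrArg (fun ν : Measure ℝ => ν Set.univ) hmap
  simp only [measure_univ, Measure.smul_apply, smul_eq_mul, mul_one] at h1
  rw [hmap, ← h1, one_smul]

end
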